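/- Let $\beta>1$ be a real number, and let $T_\beta(x)=\beta x-\lfloor\beta x\rfloor$. For $x\in[0,1)$ let $\varepsilon_k(x)=\lfloor\beta T_\beta^{k-1}x\rfloor$ ($k\ge 1$) be the digits of the $\beta$-expansion of $x$, and let \[ \omega_n(x)=\sum_{k=1}^{n}\frac{\varepsilon_k(x)}{\beta^{k}}\qquad(n\ge 1) \] be its convergents. Then the set of all $x\in[0,1)$ for which \[ \lim_{n\to\infty}\frac1n\log_\beta\bigl(x-\omega_n(x)\bigr)=-1 \] fails (that is, either the limit does not exist, or it exists in $[-\infty,\infty]$ and differs from $-1$; here $\log_\beta 0=-\infty$) has Hausdorff dimension $1$. -/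

import Mathlib

open Filter Topology

noncomputable section

namespace BetaExpansion

/-- The `β`-transformation `T_β x = β x - ⌊β x⌋`. -/
def T (β x : ℝ) : ℝ := β * x - (⌊β * x⌋ : ℝ)

/-- The digits of the `β`-expansion, indexed from `0`: `digit β x k` is the `(k+1)`-st digit
`ε_{k+1}(x) = ⌊β T_β^k x⌋`. -/
def digit (β x : ℝ) (k : ℕ) : ℤ := ⌊β * (T β)^[k] x⌋

/-- The `n`-th convergent `ω_n(x) = ε_1(x)/β + ⋯ + ε_n(x)/β^n`. -/
def convergent (β x : ℝ) (n : ℕ) : ℝ :=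
  ∑ k ∈ Finset.range n, (digit β x k : ℝ) / β ^ (k + 1)

/-- The logarithm in base `β` of a real `t ≥ 0`, with values in `[-∞, ∞]` and `log_β 0 = -∞`. -/
def extLogb (β t : ℝ) : EReal := open Classical in if t = 0 then ⊥ else (Real.logb β t : EReal)

/-- The points `x ∈ [0, 1)` for which `(1/n) log_β (x - ω_n(x)) → -1` fails, that is, for which
the limit does not exist or exists in `[-∞, ∞]` and differs from `-1`. -/
def exceptionalSet (β : ℝ) : Set ℝ :=
  {x | x ∈ Set.Ico (0 : ℝ) 1 ∧
    ¬ Tendsto (fun n : ℕ => ((1 / (n : ℝ) : ℝ) : EReal) * extLogb β (x - convergent β x n))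
      atTop (𝓝 (-1 : EReal))}

end BetaExpansion

end

namespace BetaExpansion

/-! By `sub_convergent` the error after `n` digits is `T^n x / β ^ n`, so a run of zero digits of
length proportional to its position, occurring infinitely often, keeps the limit from being `-1`.
Such runs are created in every expansion: `spread` moves the `n`-th digit of `t` to position `φ n`
and fills the gaps with zeros, and long gaps put its image in the exceptional set
(`spread_mem_exceptionalSet`).

If `φ n ≤ p * n`, the inverse of `spread` is Hölder of exponent `1 / p` (`abs_sub_le_spread`), so
the image has dimension at least `1 / p`. The choice `dyadicJump` has proportional gaps only near
powers of two, which allows `p = 1 + 2⁻ᵐ`; then `m → ∞`. -/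

/-! ### Basic facts on β-expansions. -/

lemma T_eq_fract (β x : ℝ) : T β x = Int.fract (β * x) := rfl

lemma T_mem_Ico (β x : ℝ) : T β x ∈ Set.Ico (0 : ℝ) 1 :=
  ⟨Int.fract_nonneg _, Int.fract_lt_one _⟩

lemma iterate_T_mem_Ico (β : ℝ) {x : ℝ} (hx : x ∈ Set.Ico (0 : ℝ) 1) (n : ℕ) :
    (T β)^[n] x ∈ Set.Ico (0 : ℝ) 1 := by
  cases n with
  | zero => exact hx
  | succ n => rw [Function.iterate_succ_apply']; exact T_mem_Ico _ _

lemma digit_nonneg {β : ℝ} (hβ : 1 < β) {x : ℝ} (hx : x ∈ Set.Ico (0 : ℝ) 1) (k : ℕ) :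
    0 ≤ (digit β x k : ℝ) := by
  have h := (iterate_T_mem_Ico β hx k).1
  have : 0 ≤ digit β x k := Int.floor_nonneg.2 (by positivity)
  exact_mod_cast this

lemma digit_succ (β x : ℝ) (k : ℕ) : digit β x (k + 1) = digit β (T β x) k := rfl

lemma digit_zero_add_T (β x : ℝ) : (digit β x 0 : ℝ) + T β x = β * x :=
  Int.floor_add_fract _

lemma sub_convergent {β : ℝ} (hβ : 1 < β) (x : ℝ) (n : ℕ) :
    x - convergent β x n = (T β)^[n] x / β ^ n := by
  have hβ0 : β ≠ 0 := by positivity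
  induction n with
  | zero => simp [convergent]
  | succ n ih =>
    have h : T β ((T β)^[n] x) = β * (T β)^[n] x - (digit β x n : ℝ) := rfl
    have hc : convergent β x (n + 1) = convergent β x n + (digit β x n : ℝ) / β ^ (n + 1) :=
      Finset.sum_range_succ _ _
    rw [hc, Function.iterate_succ_apply', h, ← sub_sub, ih]
    field_simp
    ring

lemma hasSum_digit {β : ℝ} (hβ : 1 < β) {x : ℝ} (hx : x ∈ Set.Ico (0 : ℝ) 1) :
    HasSum (fun k => (digit β x k : ℝ) / β ^ (k + 1)) x := by
  have hβ0 : 0 < β := by positivity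
  rw [hasSum_iff_tendsto_nat_of_nonneg
    (fun k => div_nonneg (digit_nonneg hβ hx k) (by positivity))]
  have h : Tendsto (fun n => (T β)^[n] x / β ^ n) atTop (𝓝 0) := by
    refine squeeze_zero (g := fun n : ℕ => (β⁻¹) ^ n)
      (fun n => div_nonneg (iterate_T_mem_Ico β hx n).1 (by positivity)) (fun n => ?_)
      (tendsto_pow_atTop_nhds_zero_of_lt_one (by positivity) (inv_lt_one_of_one_lt₀ hβ))
    rw [inv_pow, ← one_div]
    gcongr
    exact (iterate_T_mem_Ico β hx n).2.le
  have h2 := h.const_sub x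
  simp only [← sub_convergent hβ, sub_sub_cancel, sub_zero] at h2
  exact h2

/-! ### Spreading out the digits. -/

/-- The sum of the series with the digits of `t`, the `j`-th digit being moved to position
`φ (n + j)`. -/
noncomputable def spread (β : ℝ) (φ : ℕ → ℕ) (n : ℕ) (t : ℝ) : ℝ :=
  ∑' j, (digit β t j : ℝ) / β ^ (φ (n + j) + 1)

section spread

variable {β : ℝ} {φ : ℕ → ℕ} {t t' : ℝ}

lemma add_le_of_succ_le (hstep : ∀ n, φ n + 1 ≤ φ (n + 1)) (n j : ℕ) : φ n + j ≤ φ (n + j) := by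
  induction j with
  | zero => rfl
  | succ j ih => have := hstep (n + j); rw [← add_assoc n]; omega

lemma spread_term_le (hβ : 1 < β) (hstep : ∀ n, φ n + 1 ≤ φ (n + 1))
    (ht : t ∈ Set.Ico (0 : ℝ) 1) (n j : ℕ) :
    (digit β t j : ℝ) / β ^ (φ (n + j) + 1) ≤ (β ^ φ n)⁻¹ * ((digit β t j : ℝ) / β ^ (j + 1)) := by
  have h0 : 0 < β := by positivity
  have := digit_nonneg hβ ht j
  rw [inv_mul_eq_div, div_div, ← pow_add]
  refine div_le_div_of_nonneg_left this (by positivity) (pow_le_pow_right₀ hβ.le ?_)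
  have := add_le_of_succ_le hstep n j
  omega

lemma spread_term_nonneg (hβ : 1 < β) (φ : ℕ → ℕ) (ht : t ∈ Set.Ico (0 : ℝ) 1) (n j : ℕ) :
    0 ≤ (digit β t j : ℝ) / β ^ (φ (n + j) + 1) :=
  div_nonneg (digit_nonneg hβ ht j) (by positivity)

lemma summable_spread (hβ : 1 < β) (hstep : ∀ n, φ n + 1 ≤ φ (n + 1))
    (ht : t ∈ Set.Ico (0 : ℝ) 1) (n : ℕ) :
    Summable fun j => (digit β t j : ℝ) / β ^ (φ (n + j) + 1) :=
  Summable.of_nonneg_of_le (spread_term_nonneg hβ φ ht n) (spread_term_le hβ hstep ht n)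
    ((hasSum_digit hβ ht).summable.mul_left _)

lemma spread_nonneg (hβ : 1 < β) (φ : ℕ → ℕ) (ht : t ∈ Set.Ico (0 : ℝ) 1) (n : ℕ) :
    0 ≤ spread β φ n t :=
  tsum_nonneg (spread_term_nonneg hβ φ ht n)

lemma spread_le (hβ : 1 < β) (hstep : ∀ n, φ n + 1 ≤ φ (n + 1))
    (ht : t ∈ Set.Ico (0 : ℝ) 1) (n : ℕ) : spread β φ n t ≤ (β ^ φ n)⁻¹ * t := by
  have h := (hasSum_digit hβ ht).mul_left ((β ^ φ n)⁻¹)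
  rw [← h.tsum_eq]
  exact (summable_spread hβ hstep ht n).tsum_le_tsum (spread_term_le hβ hstep ht n) h.summable

lemma spread_eq (hβ : 1 < β) (hstep : ∀ n, φ n + 1 ≤ φ (n + 1))
    (ht : t ∈ Set.Ico (0 : ℝ) 1) (n : ℕ) :
    spread β φ n t = (digit β t 0 : ℝ) / β ^ (φ n + 1) + spread β φ (n + 1) (T β t) := by
  rw [spread, (summable_spread hβ hstep ht n).tsum_eq_zero_add, spread]
  simp only [digit_succ, add_zero]
  congr 2
  ext j
  rw [add_right_comm n 1 j, add_assoc n j 1]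

/-! ### Lower bounds for differences of spread numbers. -/

lemma inv_pow_rpow (hβ : 1 < β) (n : ℕ) (p : ℝ) : ((β ^ n)⁻¹) ^ p = β ^ (-(p * n)) := by
  have h0 : 0 < β := by positivity
  rw [← Real.rpow_natCast, ← Real.rpow_neg h0.le, ← Real.rpow_mul h0.le]
  ring_nf

lemma inv_pow_rpow_le (hβ : 1 < β) {p : ℝ} (hup : ∀ n, (φ n : ℝ) ≤ p * n) (n : ℕ) :
    ((β ^ n)⁻¹) ^ p ≤ (β ^ φ n)⁻¹ := by
  have h0 : 0 < β := by positivity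
  rw [inv_pow_rpow hβ, ← Real.rpow_natCast, ← Real.rpow_neg h0.le]
  exact Real.rpow_le_rpow_of_exponent_le hβ.le (by linarith [hup n])

/-- The first nonzero digit of `t` alone gives the bound; leading zeros are stripped by applying
`T`. -/
lemma rpow_le_spread (hβ : 1 < β) (hstep : ∀ n, φ n + 1 ≤ φ (n + 1)) {p : ℝ} (hp : 1 ≤ p)
    (hup : ∀ n, (φ n : ℝ) ≤ p * n) (ht : t ∈ Set.Ico (0 : ℝ) 1) (n : ℕ) :
    β⁻¹ * ((β ^ n)⁻¹ * t) ^ p ≤ spread β φ n t := by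
  have h0 : 0 < β := by positivity
  rcases ht.1.eq_or_lt with rfl | htpos
  · rw [mul_zero, Real.zero_rpow (by linarith), mul_zero]
    exact spread_nonneg hβ φ ht n
  -- Since `T` multiplies `t` by `β` at each zero digit, `k` bounds the number of leading zeros.
  obtain ⟨k, hk⟩ : ∃ k : ℕ, 1 ≤ β ^ k * t := by
    obtain ⟨k, hk⟩ := pow_unbounded_of_one_lt t⁻¹ hβ
    refine ⟨k, ?_⟩
    rw [← div_le_iff₀ htpos, one_div]
    exact hk.le
  clear htpos
  induction k generalizing n t with
  | zero => linarith [ht.2]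
  | succ k ih =>
    have hT := T_mem_Ico β t
    have hd := digit_zero_add_T β t
    rw [spread_eq hβ hstep ht]
    have hnn : 0 ≤ digit β t 0 := by exact_mod_cast digit_nonneg hβ ht 0
    rcases hnn.eq_or_lt with h | h
    · rw [← h, Int.cast_zero, zero_add] at hd
      have := ih hT (n + 1) (by rw [hd]; convert hk using 1; ring)
      rw [← h, Int.cast_zero, zero_div, zero_add]
      convert this using 3
      rw [hd, pow_succ]
      field_simp
    · have h1 : (1 : ℝ) ≤ digit β t 0 := by exact_mod_cast h
      have h2 := spread_nonneg hβ φ hT (n + 1)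
      calc β⁻¹ * ((β ^ n)⁻¹ * t) ^ p ≤ β⁻¹ * ((β ^ n)⁻¹) ^ p := by
            have := ht.1
            gcongr
            exact mul_le_of_le_one_right (by positivity) ht.2.le
        _ ≤ β⁻¹ * (β ^ φ n)⁻¹ := by gcongr; exact inv_pow_rpow_le hβ hup n
        _ = 1 / β ^ (φ n + 1) := by rw [pow_succ]; field_simp
        _ ≤ (digit β t 0 : ℝ) / β ^ (φ n + 1) := by gcongr
        _ ≤ _ := by linarith

lemma add_rpow_le_two_rpow_mul {a b p : ℝ} (ha : 0 ≤ a) (hb : 0 ≤ b) (hp : 1 ≤ p) :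
    (a + b) ^ p ≤ 2 ^ (p - 1) * (a ^ p + b ^ p) := by
  lift a to NNReal using ha
  lift b to NNReal using hb
  exact_mod_cast NNReal.rpow_add_le_mul_rpow_add_rpow a b hp

/-- Common leading digits are stripped by `T`. Where the digits first differ, `t` and `t'` may still
be very close, so one digit does not suffice: the rescaled difference is split into two nonnegative
parts, and convexity of the `p`-th power recombines them at the cost `2 ^ (p - 1)`. -/
lemma rpow_sub_le_spread_sub (hβ : 1 < β) (hstep : ∀ n, φ n + 1 ≤ φ (n + 1)) {p : ℝ} (hp : 1 ≤ p)
    (hup : ∀ n, (φ n : ℝ) ≤ p * n) (ht : t ∈ Set.Ico (0 : ℝ) 1) (ht' : t' ∈ Set.Ico (0 : ℝ) 1)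
    (hlt : t' < t) (n : ℕ) :
    β⁻¹ * ((β ^ n)⁻¹ * (t - t')) ^ p ≤ 2 ^ (p - 1) * (spread β φ n t - spread β φ n t') := by
  have h0 : 0 < β := by positivity
  obtain ⟨k, hk⟩ : ∃ k : ℕ, 1 ≤ β ^ k * (t - t') := by
    obtain ⟨k, hk⟩ := pow_unbounded_of_one_lt (t - t')⁻¹ hβ
    refine ⟨k, ?_⟩
    rw [← div_le_iff₀ (sub_pos.2 hlt), one_div]
    exact hk.le
  induction k generalizing n t t' with
  | zero => linarith [ht.2, ht'.1]
  | succ k ih =>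
    have hT := T_mem_Ico β t
    have hT' := T_mem_Ico β t'
    have hd := digit_zero_add_T β t
    have hd' := digit_zero_add_T β t'
    rw [spread_eq hβ hstep ht, spread_eq hβ hstep ht']
    have hmono : digit β t' 0 ≤ digit β t 0 :=
      Int.floor_le_floor (by simp only [Function.iterate_zero, id]; gcongr)
    rcases hmono.eq_or_lt with h | h
    · have hsub : T β t - T β t' = β * (t - t') := by rw [h] at hd'; linarith
      have := ih hT hT' (by nlinarith [mul_pos h0 (sub_pos.2 hlt)]) (n + 1)
        (by rw [hsub]; convert hk using 1; ring)
      rw [h, add_sub_add_left_eq_sub]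
      convert this using 3
      rw [hsub, pow_succ]
      field_simp
    · have h1 : (digit β t' 0 : ℝ) + 1 ≤ digit β t 0 := by exact_mod_cast h
      set a : ℝ := (digit β t 0 : ℝ)
      set a' : ℝ := (digit β t' 0 : ℝ)
      -- `β * (t - t') = A + T β t`: the digit gap less the tail of `t'`, plus the tail of `t`.
      set A : ℝ := a - a' - T β t' with hA
      have hA0 : 0 ≤ A := by linarith [hT'.2]
      have hAβ : A ≤ β := by nlinarith [hT.1, ht.2, ht'.1]
      have hsplit : (β ^ n)⁻¹ * (t - t') = (β ^ (n + 1))⁻¹ * A + (β ^ (n + 1))⁻¹ * T β t := by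
        have : A + T β t = β * (t - t') := by linarith
        rw [← mul_add, this, pow_succ]
        field_simp
      have hB := rpow_le_spread hβ hstep hp hup hT (n + 1)
      have hC : spread β φ (n + 1) (T β t') ≤ (β ^ (φ n + 1))⁻¹ * T β t' := by
        refine (spread_le hβ hstep hT' (n + 1)).trans ?_
        have := hT'.1
        gcongr
        · exact hβ.le
        · exact hstep n
      have hD : β⁻¹ * ((β ^ (n + 1))⁻¹ * A) ^ p ≤ (β ^ (φ n + 1))⁻¹ * A := by
        have h3 : (β⁻¹ * A) ^ p ≤ β⁻¹ * A := by
          refine Real.rpow_le_self_of_le_one (by positivity) ?_ hp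
          rw [inv_mul_le_iff₀ h0]; linarith
        calc β⁻¹ * ((β ^ (n + 1))⁻¹ * A) ^ p ≤ 1 * ((β ^ (n + 1))⁻¹ * A) ^ p := by
              gcongr; exact (inv_lt_one_of_one_lt₀ hβ).le
          _ = ((β ^ n)⁻¹) ^ p * (β⁻¹ * A) ^ p := by
              rw [one_mul, ← Real.mul_rpow (by positivity) (by positivity), pow_succ, mul_inv,
                mul_assoc]
          _ ≤ (β ^ φ n)⁻¹ * (β⁻¹ * A) := by
              gcongr
              exact inv_pow_rpow_le hβ hup n
          _ = _ := by rw [pow_succ, mul_inv, mul_assoc]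
      calc β⁻¹ * ((β ^ n)⁻¹ * (t - t')) ^ p
          ≤ β⁻¹ * (2 ^ (p - 1) *
            (((β ^ (n + 1))⁻¹ * A) ^ p + ((β ^ (n + 1))⁻¹ * T β t) ^ p)) := by
            rw [hsplit]
            have := hT.1
            gcongr
            exact add_rpow_le_two_rpow_mul (by positivity) (by positivity) hp
        _ = 2 ^ (p - 1) * (β⁻¹ * ((β ^ (n + 1))⁻¹ * A) ^ p
            + β⁻¹ * ((β ^ (n + 1))⁻¹ * T β t) ^ p) := by ring
        _ ≤ 2 ^ (p - 1) * ((β ^ (φ n + 1))⁻¹ * A + spread β φ (n + 1) (T β t)) := by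
            gcongr
        _ ≤ _ := by
            gcongr
            rw [hA, div_eq_inv_mul, div_eq_inv_mul]
            linarith

/-! ### The orbit of a spread number and its convergents. -/

lemma iterate_T_eq_mul (hβ : 1 < β) {z : ℝ} (hz : 0 ≤ z) {i : ℕ} (h : β ^ i * z < 1) :
    (T β)^[i] z = β ^ i * z := by
  have h0 : 0 < β := by positivity
  induction i with
  | zero => simp
  | succ i ih =>
    have hle : β ^ i * z ≤ β ^ (i + 1) * z := by
      gcongr
      · exact hβ.le
      · omega
    rw [Function.iterate_succ_apply', ih (hle.trans_lt h), T_eq_fract, ← mul_assoc, ← pow_succ',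
      Int.fract_eq_self.2 ⟨by positivity, h⟩]

/-- Delaying digits only shrinks the tails. This is why the spread digits are again a genuine
β-expansion: no scaled tail reaches `1`. -/
lemma pow_mul_spread_mem_Ico (hβ : 1 < β) (hstep : ∀ n, φ n + 1 ≤ φ (n + 1))
    (ht : t ∈ Set.Ico (0 : ℝ) 1) {n i : ℕ} (hi : i ≤ φ n) :
    β ^ i * spread β φ n t ∈ Set.Ico (0 : ℝ) 1 := by
  have h0 : 0 < β := by positivity
  have hs := spread_nonneg hβ φ ht n
  refine ⟨by positivity, ?_⟩
  calc β ^ i * spread β φ n t ≤ β ^ φ n * ((β ^ φ n)⁻¹ * t) := by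
        gcongr
        · exact hβ.le
        · exact spread_le hβ hstep ht n
    _ = t := by field_simp
    _ < 1 := ht.2

lemma T_pow_mul_spread (hβ : 1 < β) (hstep : ∀ n, φ n + 1 ≤ φ (n + 1))
    (ht : t ∈ Set.Ico (0 : ℝ) 1) (n : ℕ) :
    T β (β ^ φ n * spread β φ n t) = β ^ (φ n + 1) * spread β φ (n + 1) (T β t) := by
  have h0 : 0 < β := by positivity
  have h : β * (β ^ φ n * spread β φ n t)
      = (digit β t 0 : ℤ) + β ^ (φ n + 1) * spread β φ (n + 1) (T β t) := by
    rw [spread_eq hβ hstep ht, ← mul_assoc, ← pow_succ', mul_add]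
    field_simp
  rw [T_eq_fract, h, Int.fract_intCast_add, Int.fract_eq_self]
  exact pow_mul_spread_mem_Ico hβ hstep (T_mem_Ico β t) (hstep n)

lemma iterate_T_spread (hβ : 1 < β) (hφ0 : φ 0 = 0) (hstep : ∀ n, φ n + 1 ≤ φ (n + 1))
    (ht : t ∈ Set.Ico (0 : ℝ) 1) (n : ℕ) :
    (T β)^[φ n] (spread β φ 0 t) = β ^ φ n * spread β φ n ((T β)^[n] t) := by
  have h0 : 0 < β := by positivity
  induction n with
  | zero => simp [hφ0]
  | succ n ih =>
    obtain ⟨i, hi⟩ := Nat.exists_eq_add_of_le' (hstep n)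
    have htn := iterate_T_mem_Ico β ht n
    have ht1 := iterate_T_mem_Ico β ht (n + 1)
    have hs := spread_nonneg hβ φ ht1 (n + 1)
    have hlt := pow_mul_spread_mem_Ico hβ hstep ht1 (le_refl (φ (n + 1)))
    rw [hi, pow_add, mul_assoc] at hlt
    rw [hi, Function.iterate_add_apply, Function.iterate_succ_apply', ih,
      T_pow_mul_spread hβ hstep htn, ← Function.iterate_succ_apply' (T β),
      iterate_T_eq_mul hβ (by positivity) hlt.2, pow_add β i, mul_assoc]

lemma iterate_T_succ_spread (hβ : 1 < β) (hφ0 : φ 0 = 0) (hstep : ∀ n, φ n + 1 ≤ φ (n + 1))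
    (ht : t ∈ Set.Ico (0 : ℝ) 1) (n : ℕ) :
    (T β)^[φ n + 1] (spread β φ 0 t)
      = β ^ (φ n + 1) * spread β φ (n + 1) ((T β)^[n + 1] t) := by
  rw [Function.iterate_succ_apply', iterate_T_spread hβ hφ0 hstep ht,
    T_pow_mul_spread hβ hstep (iterate_T_mem_Ico β ht n), Function.iterate_succ_apply']

lemma spread_sub_convergent_le (hβ : 1 < β) (hφ0 : φ 0 = 0) (hstep : ∀ n, φ n + 1 ≤ φ (n + 1))
    (ht : t ∈ Set.Ico (0 : ℝ) 1) (n : ℕ) :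
    spread β φ 0 t - convergent β (spread β φ 0 t) (φ n + 1) ∈ Set.Icc 0 (β ^ φ (n + 1))⁻¹ := by
  have h0 : 0 < β := by positivity
  have ht1 := iterate_T_mem_Ico β ht (n + 1)
  rw [sub_convergent hβ, iterate_T_succ_spread hβ hφ0 hstep ht,
    mul_div_cancel_left₀ _ (by positivity)]
  exact ⟨spread_nonneg hβ φ ht1 _, (spread_le hβ hstep ht1 _).trans
    (mul_le_of_le_one_right (by positivity) ht1.2.le)⟩

lemma mul_extLogb_le {β c u : ℝ} (hβ : 1 < β) {N M : ℕ} (hN : 0 < N) (hNM : (1 + c) * N ≤ M)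
    (hu : u ∈ Set.Icc 0 (β ^ M)⁻¹) :
    ((1 / (N : ℝ) : ℝ) : EReal) * extLogb β u ≤ ((-1 - c : ℝ) : EReal) := by
  have h0 : 0 < β := by positivity
  have hN' : (0 : ℝ) < N := by exact_mod_cast hN
  unfold extLogb
  split_ifs with h
  · rw [EReal.coe_mul_bot_of_pos (by positivity)]
    exact bot_le
  · have hupos : 0 < u := lt_of_le_of_ne hu.1 (Ne.symm h)
    have hlog : Real.logb β u ≤ -M := by
      rw [Real.logb_le_iff_le_rpow hβ hupos, Real.rpow_neg h0.le, Real.rpow_natCast]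
      exact hu.2
    rw [← EReal.coe_mul, EReal.coe_le_coe_iff, one_div, inv_mul_le_iff₀ hN']
    linarith

/-- At the convergents of length `φ n + 1`, which end just before a gap, the normalized logarithm is
infinitely often at most `-1 - c`. -/
lemma spread_mem_exceptionalSet (hβ : 1 < β) (hφ0 : φ 0 = 0) (hstep : ∀ n, φ n + 1 ≤ φ (n + 1))
    {c : ℝ} (hc : 0 < c) (hgap : ∃ᶠ n in atTop, (1 + c) * (φ n + 1 : ℕ) ≤ φ (n + 1))
    (ht : t ∈ Set.Ico (0 : ℝ) 1) : spread β φ 0 t ∈ exceptionalSet β := by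
  refine ⟨by simpa using pow_mul_spread_mem_Ico hβ hstep ht (Nat.zero_le (φ 0)), fun hlim => ?_⟩
  have hφ : Tendsto (fun n => φ n + 1) atTop atTop :=
    tendsto_atTop_mono (fun n => by have := add_le_of_succ_le hstep 0 n; simp at this; simp; omega)
      tendsto_id
  have hlt : ((-1 - c : ℝ) : EReal) < -1 := by
    rw [← EReal.coe_one, ← EReal.coe_neg, EReal.coe_lt_coe_iff]; linarith
  obtain ⟨n, hn, hn'⟩ := (hgap.and_eventually
    ((hlim.comp hφ).eventually (lt_mem_nhds hlt))).exists
  exact (mul_extLogb_le hβ (Nat.succ_pos _) hn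
    (spread_sub_convergent_le hβ hφ0 hstep ht n)).not_gt hn'

/-! ### Dimension of the set of spread numbers. -/

lemma abs_sub_le_spread (hβ : 1 < β) (hstep : ∀ n, φ n + 1 ≤ φ (n + 1)) {p : ℝ} (hp : 1 ≤ p)
    (hup : ∀ n, (φ n : ℝ) ≤ p * n) (ht : t ∈ Set.Ico (0 : ℝ) 1) (ht' : t' ∈ Set.Ico (0 : ℝ) 1) :
    |t - t'| ≤ (β * 2 ^ (p - 1)) ^ p⁻¹ * |spread β φ 0 t - spread β φ 0 t'| ^ p⁻¹ := by
  have h0 : 0 < β := by positivity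
  wlog hle : t' ≤ t generalizing t t'
  · rw [abs_sub_comm, abs_sub_comm (spread β φ 0 t)]
    exact this ht' ht (le_of_not_ge hle)
  rcases hle.eq_or_lt with rfl | hlt
  · rw [sub_self, abs_zero]; positivity
  have h := rpow_sub_le_spread_sub hβ hstep hp hup ht ht' hlt 0
  rw [pow_zero, inv_one, one_mul, inv_mul_le_iff₀ h0, ← mul_assoc] at h
  rw [abs_of_pos (sub_pos.2 hlt), ← Real.mul_rpow (by positivity) (abs_nonneg _)]
  have hd := sub_pos.2 hlt
  rw [Real.le_rpow_inv_iff_of_pos hd.le (by positivity) (by linarith)]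
  exact h.trans (by gcongr; exact le_abs_self _)

/-- The `1 / p`-Hölder inverse maps the image onto `[0, 1)` and multiplies dimension by at most `p`.
-/
lemma inv_le_dimH_spread_image (hβ : 1 < β) (hstep : ∀ n, φ n + 1 ≤ φ (n + 1)) {p : NNReal}
    (hp : 1 ≤ p) (hup : ∀ n, (φ n : ℝ) ≤ p * n) :
    ((p⁻¹ : NNReal) : ENNReal) ≤ dimH (spread β φ 0 '' Set.Ico (0 : ℝ) 1) := by
  have hp0 : 0 < p := by positivity
  have hbound := fun {t t'} (ht : t ∈ Set.Ico (0 : ℝ) 1) (ht' : t' ∈ Set.Ico (0 : ℝ) 1) =>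
    abs_sub_le_spread hβ hstep (p := p) (by exact_mod_cast hp) hup ht ht'
  have hinj : Set.InjOn (spread β φ 0) (Set.Ico (0 : ℝ) 1) := by
    intro t ht t' ht' h
    have := hbound ht ht'
    rw [h, sub_self, abs_zero, Real.zero_rpow (by positivity), mul_zero] at this
    exact sub_eq_zero.1 (abs_nonpos_iff.1 this)
  set f := Function.invFunOn (spread β φ 0) (Set.Ico (0 : ℝ) 1)
  have hf : ∀ t ∈ Set.Ico (0 : ℝ) 1, f (spread β φ 0 t) = t := hinj.leftInvOn_invFunOn
  have hC : 0 ≤ (β * 2 ^ ((p : ℝ) - 1)) ^ (p : ℝ)⁻¹ := by positivity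
  have hold : HolderOnWith ((β * 2 ^ ((p : ℝ) - 1)) ^ (p : ℝ)⁻¹).toNNReal p⁻¹ f (spread β φ 0 '' Set.Ico (0 : ℝ) 1) := by
    rintro _ ⟨t, ht, rfl⟩ _ ⟨t', ht', rfl⟩
    rw [hf t ht, hf t' ht', edist_dist, edist_dist, Real.dist_eq, Real.dist_eq,
      ENNReal.ofReal_rpow_of_nonneg (abs_nonneg _) (by positivity), ← ENNReal.ofReal,
      ← ENNReal.ofReal_mul hC]
    exact ENNReal.ofReal_le_ofReal (by simpa using hbound ht ht')
  have hdim := hold.dimH_image_le (inv_pos.2 hp0)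
  have himage : f '' (spread β φ 0 '' Set.Ico (0 : ℝ) 1) = Set.Ico (0 : ℝ) 1 :=
    hinj.leftInvOn_invFunOn.image_image
  rw [himage, Real.dimH_of_nonempty_interior (by simp [interior_Ico])] at hdim
  rwa [ENNReal.le_div_iff_mul_le (by left; simpa using hp0.ne') (by left; simp), Module.finrank_self, Nat.cast_one,
    one_mul] at hdim

end spread

/-! ### The sparse jump sequence and the limit `m → ∞`. -/

/-- A strictly increasing sequence with `n ≤ φ n ≤ (1 + 2⁻ᵐ) n`, which makes a jump of size
proportional to `n` at each large power `n` of two. -/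
def dyadicJump (m n : ℕ) : ℕ := n + 2 ^ Nat.log 2 n / 2 ^ m

lemma dyadicJump_zero {m : ℕ} (hm : 0 < m) : dyadicJump m 0 = 0 := by
  simp [dyadicJump, Nat.div_eq_of_lt, hm.ne']

lemma dyadicJump_succ_le (m n : ℕ) : dyadicJump m n + 1 ≤ dyadicJump m (n + 1) := by
  have : 2 ^ Nat.log 2 n / 2 ^ m ≤ 2 ^ Nat.log 2 (n + 1) / 2 ^ m :=
    Nat.div_le_div_right (Nat.pow_le_pow_right two_pos (Nat.log_mono_right n.le_succ))
  unfold dyadicJump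
  omega

lemma dyadicJump_le {m : ℕ} (hm : 0 < m) (n : ℕ) :
    (dyadicJump m n : ℝ) ≤ (1 + (1 / 2) ^ m) * n := by
  rcases Nat.eq_zero_or_pos n with rfl | hn
  · simp [dyadicJump_zero hm]
  have h : (2 : ℝ) ^ Nat.log 2 n ≤ n := by exact_mod_cast Nat.pow_log_le_self 2 hn.ne'
  have h1 : ((2 ^ Nat.log 2 n / 2 ^ m : ℕ) : ℝ) ≤ 2 ^ Nat.log 2 n / 2 ^ m := by
    exact_mod_cast Nat.cast_div_le
  have h2 : (2 : ℝ) ^ Nat.log 2 n / 2 ^ m ≤ n / 2 ^ m := by gcongr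
  rw [dyadicJump, Nat.cast_add, add_mul, one_mul, one_div, inv_pow, inv_mul_eq_div]
  linarith

lemma frequently_dyadicJump (m : ℕ) :
    ∃ᶠ n in atTop, (1 + (1 / 2 : ℝ) ^ (m + 2)) * (dyadicJump m n + 1 : ℕ)
      ≤ dyadicJump m (n + 1) := by
  rw [frequently_atTop]
  intro a
  have h1 : 0 < 2 ^ (m + a + 1) := by positivity
  have ha : a < 2 ^ (m + a + 1) := Nat.lt_two_pow_self.trans_le
    (Nat.pow_le_pow_right two_pos (by omega))
  have hlog : Nat.log 2 (2 ^ (m + a + 1) - 1) = m + a := by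
    have h2 : 0 < 2 ^ (m + a) := by positivity
    rw [Nat.log_eq_iff (Or.inr ⟨one_lt_two, by rw [pow_succ]; omega⟩)]
    exact ⟨by rw [pow_succ]; omega, by omega⟩
  -- Passing to the next power of two doubles the shift from `2 ^ a` to `2 ^ (a + 1)`, leaving `2 ^
  -- a` zeros.
  refine ⟨2 ^ (m + a + 1) - 1, by omega, ?_⟩
  have e1 : dyadicJump m (2 ^ (m + a + 1) - 1) + 1 = 2 ^ (m + a + 1) + 2 ^ a := by
    rw [dyadicJump, hlog, pow_add 2 m a, Nat.mul_div_cancel_left _ (by positivity)]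
    omega
  have e2 : dyadicJump m (2 ^ (m + a + 1) - 1 + 1) = 2 ^ (m + a + 1) + 2 ^ (a + 1) := by
    rw [Nat.sub_add_cancel h1, dyadicJump, Nat.log_pow one_lt_two]
    rw [show 2 ^ (m + a + 1) / 2 ^ m = 2 ^ (a + 1) by
      rw [add_assoc, pow_add 2 m, Nat.mul_div_cancel_left _ (by positivity)]]
  rw [e1, e2]
  push_cast
  have hm : (1 : ℝ) ≤ 2 ^ m := one_le_pow₀ one_le_two
  have hpos : (0 : ℝ) < 2 ^ a := by positivity
  have h3 : (1 / 2 : ℝ) ^ (m + 2) * (2 ^ (m + a + 1) + 2 ^ a) ≤ 2 ^ a := by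
    rw [one_div, inv_pow, inv_mul_le_iff₀ (by positivity)]
    simp only [pow_add, pow_one]
    nlinarith
  rw [add_mul, one_mul, pow_succ 2 a]
  linarith

lemma inv_le_dimH_exceptionalSet {β : ℝ} (hβ : 1 < β) {m : ℕ} (hm : 0 < m) :
    (((1 + (1 / 2) ^ m)⁻¹ : NNReal) : ENNReal) ≤ dimH (exceptionalSet β) := by
  refine (inv_le_dimH_spread_image hβ (dyadicJump_succ_le m) (le_add_of_nonneg_right (by positivity))
    (fun n => by simpa using dyadicJump_le hm n)).trans (dimH_mono ?_)
  rintro _ ⟨t, ht, rfl⟩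
  exact spread_mem_exceptionalSet hβ (dyadicJump_zero hm) (dyadicJump_succ_le m)
    (by positivity) (frequently_dyadicJump m) ht

end BetaExpansion

theorem corollary2 (β : ℝ) (hβ : 1 < β) :
    dimH (BetaExpansion.exceptionalSet β) = 1 := by
  refine le_antisymm ((dimH_mono (Set.subset_univ _)).trans Real.dimH_univ.le) ?_
  have hlim : Tendsto (fun m : ℕ => (((1 + (1 / 2) ^ m)⁻¹ : NNReal) : ENNReal)) atTop (𝓝 1) := by
    rw [← ENNReal.coe_one, ENNReal.tendsto_coe]
    have h := tendsto_pow_atTop_nhds_zero_of_lt_one (r := (1 / 2 : NNReal)) (by positivity)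
      (by norm_num)
    simpa using (h.const_add 1).inv₀ (by simp)
  exact le_of_tendsto hlim ((eventually_gt_atTop 0).mono fun m hm =>
    BetaExpansion.inv_le_dimH_exceptionalSet hβ hm)
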